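/- Throughout, all groups are finite, $I$ is an index set, and $\sigma=\{\sigma_i\mid i\in I\}$ is a partition of the set $\mathbb P$ of all primes, that is, $\mathbb P=\bigcup_{i\in I}\sigma_i$ and $\sigma_i\cap\sigma_j=\emptyset$ for all $i\neq j$. For a group $G$, $\sigma(G)$ is the set of those $\sigma_i$ that contain a prime divisor of $|G|$. For a set $\pi$ of primes, a Hall $\pi$-subgroup of $G$ is a subgroup $H$ such that all prime divisors of $|H|$ lie in $\pi$ and no prime divisor of $|G:H|$ lies in $\pi$; $O_\pi(G)$ is the subgroup generated by all normal $\pi$-subgroups of $G$; a $\pi'$-element is an element whose order is divisible by no prime in $\pi$. The group $G$ is *$\sigma$-primary* if it is a $\sigma_i$-group for some $i$; *$\sigma$-nilpotent* if it is a direct product of $\sigma$-primary groups; *$\sigma$-full* if it has a Hall $\sigma_i$-subgroup for every $\sigma_i\in\sigma(G)$. The *$\sigma$-nilpotent residual* $G^{\mathfrak N_\sigma}$ is the intersection of all normal subgroups $N$ of $G$ with $G/N$ $\sigma$-nilpotent. A subgroup $A$ of $G$ is *$\sigma$-permutable* in $G$ if either $A\trianglelefteq G$, or $G$ is $\sigma$-full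 and $AH=HA$ for every Hall $\sigma_i$-subgroup $H$ of $G$ and every $\sigma_i\in\sigma(G)$. The group $G$ is a *$P\sigma T$-group* if $\sigma$-permutability is transitive on $G$: whenever $K$ is $\sigma$-permutable in $G$ and $H\le K$ is $\sigma$-permutable in $K$, then $H$ is $\sigma$-permutable in $G$. The group $G$ *satisfies $\mathbf N_{\pi}$* if, whenever $N$ is a soluble normal subgroup of $G$, every $\pi'$-element of $G$ induces by conjugation a power automorphism in $O_\pi(G/N)$, i.e. maps every subgroup of $O_\pi(G/N)$ onto itself. The group $G$ is *supersoluble* if all its chief factors are cyclic, and a *$\sigma$-$SC$-group* if every chief factor $H/K$ of $G$ with $H\le G^{\mathfrak N_\sigma}$ is simple. **Proposition 2.29.** Let $G$ be a finite $P\sigma T$-group. Then: (i) if $G$ is $\sigma$-full, then $G/R$ satisfies $\mathbf N_{\sigma_i}$ for every normal subgroup $R$ of $G$ and all $i\in I$; (ii) if, for all $i\in I$, all Hall $\sigma_i$-subgroups of $G$ are supersoluble, then $G$ is a $\sigma$-$SC$-group. -/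

import Mathlib

open scoped Pointwise

namespace SigmaGroup

/-- A partition `σ = {σ i | i ∈ I}` of the set of all primes: the cells consist of primes,
cover all primes and are pairwise disjoint. -/
def IsPrimePartition {I : Type*} (σ : I → Set ℕ) : Prop :=
  (⋃ i, σ i) = {p : ℕ | p.Prime} ∧ ∀ i j, i ≠ j → σ i ∩ σ j = ∅

/-- `π(n) ⊆ π`: every prime divisor of `n` lies in `π`. -/
def IsPiNumber (π : Set ℕ) (n : ℕ) : Prop :=
  ∀ p : ℕ, p.Prime → p ∣ n → p ∈ π

/-- `n` is a `π'`-number: no prime divisor of `n` lies in `π`. -/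
def IsPiPrimeNumber (π : Set ℕ) (n : ℕ) : Prop :=
  ∀ p : ℕ, p.Prime → p ∣ n → p ∉ π

/-- `H` is a Hall `π`-subgroup of the (finite) group `G`. -/
def IsHallSubgroup (π : Set ℕ) {G : Type*} [Group G] (H : Subgroup G) : Prop :=
  IsPiNumber π (Nat.card H) ∧ IsPiPrimeNumber π H.index

/-- `σ i ∈ σ(G)`, that is, `σ i ∩ π(|G|) ≠ ∅`. -/
def MemSigma {I : Type*} (σ : I → Set ℕ) (G : Type*) [Group G] (i : I) : Prop :=
  ∃ p ∈ σ i, p.Prime ∧ p ∣ Nat.card G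

/-- `G` is `σ`-primary: it is a `σ i`-group for some `i`. -/
def IsSigmaPrimary {I : Type*} (σ : I → Set ℕ) (G : Type*) [Group G] : Prop :=
  ∃ i, IsPiNumber (σ i) (Nat.card G)

/-- `G` is `σ`-nilpotent: it is a (finite) direct product of `σ`-primary groups. -/
def IsSigmaNilpotent {I : Type*} (σ : I → Set ℕ) (G : Type*) [Group G] : Prop :=
  ∃ (n : ℕ) (H : Fin n → Subgroup G),
    (∀ k, IsSigmaPrimary σ (H k)) ∧ Nonempty (G ≃* (∀ k, H k))

/-- The `σ`-nilpotent residual of `G`: the intersection of all normal subgroups `N` of `G`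
with `σ`-nilpotent quotient `G / N`. -/
def sigmaNilpotentResidual {I : Type*} (σ : I → Set ℕ) (G : Type*) [Group G] : Subgroup G :=
  sInf {N : Subgroup G | ∃ _ : N.Normal, IsSigmaNilpotent σ (G ⧸ N)}

/-- `H / K` is a chief factor of `G`: `K < H` are normal subgroups of `G` and no normal subgroup
of `G` lies strictly between them. -/
structure IsChiefFactor {G : Type*} [Group G] (K H : Subgroup G) : Prop where
  normal_bot : K.Normal
  normal_top : H.Normal
  lt : K < H
  eq_or_eq : ∀ M : Subgroup G, M.Normal → K ≤ M → M ≤ H → M = K ∨ M = H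

/-- The (finite) group `G` is supersoluble: every chief factor of `G` is cyclic. -/
def IsSupersoluble (G : Type*) [Group G] : Prop :=
  ∀ K H : Subgroup G, ∀ h : IsChiefFactor K H,
    haveI := h.normal_bot
    IsCyclic (H ⧸ K.subgroupOf H)

/-- `G` is a `σ`-`SC`-group: every chief factor of `G` below the `σ`-nilpotent residual
is simple. -/
def IsSigmaSCGroup {I : Type*} (σ : I → Set ℕ) (G : Type*) [Group G] : Prop :=
  ∀ K H : Subgroup G, ∀ h : IsChiefFactor K H, H ≤ sigmaNilpotentResidual σ G →
    haveI := h.normal_bot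
    IsSimpleGroup (H ⧸ K.subgroupOf H)

/-- `G` is `σ`-full: it has a Hall `σ i`-subgroup for every `σ i ∈ σ(G)`. -/
def IsSigmaFull {I : Type*} (σ : I → Set ℕ) (G : Type*) [Group G] : Prop :=
  ∀ i, MemSigma σ G i → ∃ H : Subgroup G, IsHallSubgroup (σ i) H

/-- `A` permutes with `B`, that is, `AB = BA`. -/
def Permutes {G : Type*} [Group G] (A B : Subgroup G) : Prop :=
  (A : Set G) * (B : Set G) = (B : Set G) * (A : Set G)

/-- `A` is `σ`-permutable in `G`: either `A` is normal in `G`, or `G` is `σ`-full and `A` permutes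
with all Hall `σ i`-subgroups of `G`, for every `σ i ∈ σ(G)`. -/
def IsSigmaPermutable {I : Type*} (σ : I → Set ℕ) {G : Type*} [Group G] (A : Subgroup G) : Prop :=
  A.Normal ∨ (IsSigmaFull σ G ∧
    ∀ i, MemSigma σ G i → ∀ H : Subgroup G, IsHallSubgroup (σ i) H → Permutes A H)

/-- `G` is a `PσT`-group: `σ`-permutability is transitive on `G`. -/
def IsPSigmaTGroup {I : Type*} (σ : I → Set ℕ) (G : Type*) [Group G] : Prop :=
  ∀ H K : Subgroup G, H ≤ K → IsSigmaPermutable σ (H.subgroupOf K) →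
    IsSigmaPermutable σ K → IsSigmaPermutable σ H

/-- `O_π(G)`: the subgroup generated by all normal `π`-subgroups of `G`. -/
def piCore (π : Set ℕ) (G : Type*) [Group G] : Subgroup G :=
  sSup {N : Subgroup G | N.Normal ∧ IsPiNumber π (Nat.card N)}

/-- `g` induces by conjugation a power automorphism in the subgroup `W` of `G`, that is, it maps
every subgroup of `W` onto itself. -/
def InducesPowerAutomorphism {G : Type*} [Group G] (g : G) (W : Subgroup G) : Prop :=
  ∀ V : Subgroup G, V ≤ W → V.map (MulAut.conj g).toMonoidHom = V

/-- `G` satisfies `N_π`: whenever `N` is a soluble normal subgroup of `G`, the `π'`-elements of `G`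
induce power automorphisms in `O_π(G / N)`. -/
def SatisfiesN (π : Set ℕ) (G : Type*) [Group G] : Prop :=
  ∀ (N : Subgroup G) [N.Normal], Group.IsSolvable N →
    ∀ g : G, IsPiPrimeNumber π (orderOf g) →
      InducesPowerAutomorphism (g : G ⧸ N) (piCore π (G ⧸ N))

end SigmaGroup

/-!
Subgroups of a quotient `Q` of `G` are pulled back along a surjection `f : G →* Q` before
`σ`-permutability is used, because a Hall subgroup of `Q` need not be the image of one of `G`.

Let `G` be `σ`-full and let `W` be a normal `σ i`-subgroup of `Q`. A Hall subgroup of `f⁻¹ W` has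
image `1` or `W`, so for each `V ≤ W` the preimage `f⁻¹ V` is `σ`-permutable in `f⁻¹ W`, and hence
in `G`. Thus `V` permutes with the image of a Hall `σ j`-subgroup for `j ≠ i`; as this image meets
`W` trivially, it normalizes `V`. The elements inducing power automorphisms in `W` therefore form a
normal subgroup of `σ i`-index, which contains all `σ i'`-elements.

For (ii), let `N` be minimal normal in `Q` and `B` minimal normal in `N`. Suppose `B` is not normal
in `Q`. Then the image `L` of some Hall `σ i`-subgroup permutes with `B` without normalizing it. A
conjugate of `B` by an element of `L` meets `B` trivially and embeds modulo `B` in `L ∩ N`, so `B`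
is a `σ i`-group, and so is `N`. Hence `N ≤ L`, and a minimal normal subgroup of the supersoluble
group `L` inside `N` is cyclic, and normal in `Q` by the preceding paragraph, so `N` is cyclic. But
then `B` is characteristic in `N`, a contradiction. So `B = N`, and `N` is simple.
-/

namespace SigmaGroup

open Subgroup

section Numbers

variable {π : Set ℕ} {m n : ℕ}

lemma isPiNumber_one (π : Set ℕ) : IsPiNumber π 1 :=
  fun _ hp hd => absurd hd hp.not_dvd_one

lemma IsPiNumber.of_dvd (h : IsPiNumber π n) (hd : m ∣ n) : IsPiNumber π m :=
  fun p hp hpm => h p hp (hpm.trans hd)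

lemma IsPiPrimeNumber.of_dvd (h : IsPiPrimeNumber π n) (hd : m ∣ n) : IsPiPrimeNumber π m :=
  fun p hp hpm => h p hp (hpm.trans hd)

lemma IsPiNumber.mul (hm : IsPiNumber π m) (hn : IsPiNumber π n) : IsPiNumber π (m * n) :=
  fun p hp hd => (hp.dvd_mul.1 hd).elim (hm p hp) (hn p hp)

lemma IsPiNumber.eq_one (h : IsPiNumber π n) (h' : IsPiPrimeNumber π n) : n = 1 :=
  Nat.eq_one_iff_not_exists_prime_dvd.2 fun p hp hd => h' p hp hd (h p hp hd)

variable {I : Type*} {σ : I → Set ℕ} {i j : I}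

lemma IsPrimePartition.exists_mem (hσ : IsPrimePartition σ) {p : ℕ} (hp : p.Prime) :
    ∃ i, p ∈ σ i :=
  Set.mem_iUnion.1 (hσ.1.ge hp)

lemma IsPrimePartition.isPiPrimeNumber_of_ne (hσ : IsPrimePartition σ) (hij : i ≠ j)
    (h : IsPiNumber (σ i) n) : IsPiPrimeNumber (σ j) n :=
  fun p hp hd hpj => (hσ.2 i j hij).le ⟨h p hp hd, hpj⟩

lemma IsPrimePartition.isPiNumber_of_forall_ne (hσ : IsPrimePartition σ)
    (h : ∀ j, j ≠ i → IsPiPrimeNumber (σ j) n) : IsPiNumber (σ i) n := by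
  intro p hp hd
  obtain ⟨j, hpj⟩ := hσ.exists_mem hp
  obtain rfl : j = i := by_contra fun hji => h j hji p hp hd hpj
  exact hpj

lemma IsPrimePartition.eq_one_of_forall (hσ : IsPrimePartition σ)
    (h : ∀ j, IsPiPrimeNumber (σ j) n) : n = 1 :=
  Nat.eq_one_iff_not_exists_prime_dvd.2 fun p hp hd =>
    let ⟨j, hpj⟩ := hσ.exists_mem hp
    h j p hp hd hpj

end Numbers

section PiSubgroups

variable {π : Set ℕ} {G Q : Type*} [Group G] [Group Q]

lemma isPiNumber_card_sup {M N : Subgroup G} [M.Normal] (hM : IsPiNumber π (Nat.card M))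
    (hN : IsPiNumber π (Nat.card N)) : IsPiNumber π (Nat.card ↥(M ⊔ N)) := by
  rw [← relIndex_bot_left, ← relIndex_mul_relIndex ⊥ M (M ⊔ N) bot_le le_sup_left,
    relIndex_bot_left, relIndex_sup_left]
  exact hM.mul (hN.of_dvd (relIndex_dvd_card M N))

lemma mem_of_isPiPrimeNumber_orderOf {N : Subgroup G} [N.Normal] (hN : IsPiNumber π N.index)
    {g : G} (hg : IsPiPrimeNumber π (orderOf g)) : g ∈ N := by
  rw [← QuotientGroup.eq_one_iff, ← orderOf_eq_one_iff]
  exact (hN.of_dvd (orderOf_dvd_natCard _)).eq_one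
    (hg.of_dvd (orderOf_map_dvd (QuotientGroup.mk' N) g))

lemma piCore_normal_and_isPiNumber_card [Finite G] (π : Set ℕ) :
    (piCore π G).Normal ∧ IsPiNumber π (Nat.card (piCore π G)) := by
  have hclosed : SupClosed {N : Subgroup G | N.Normal ∧ IsPiNumber π (Nat.card N)} := by
    rintro M ⟨hM, hMπ⟩ N ⟨hN, hNπ⟩
    exact ⟨sup_normal M N, isPiNumber_card_sup hMπ hNπ⟩
  have hbot : (⊥ : Subgroup G).Normal ∧ IsPiNumber π (Nat.card (⊥ : Subgroup G)) :=
    ⟨inferInstance, card_bot (G := G) ▸ isPiNumber_one π⟩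
  exact CompleteLattice.WellFoundedGT.isSupClosedCompact _ inferInstance _ ⟨⊥, hbot⟩ hclosed

lemma piCore_characteristic (π : Set ℕ) (G : Type*) [Group G] : (piCore π G).Characteristic := by
  refine characteristic_iff_le_comap.2 fun φ => sSup_le fun N hN => map_le_iff_le_comap.1 ?_
  refine le_sSup ⟨hN.1.map _ φ.surjective, ?_⟩
  exact hN.2.of_dvd (card_map_dvd N _)

lemma relIndex_dvd_index_of_right_normal [Finite G] (L N : Subgroup G) [N.Normal] :
    L.relIndex N ∣ L.index := by
  have hL := relIndex_mul_relIndex (N ⊓ L) L (N ⊔ L) inf_le_right le_sup_right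
  have hN := relIndex_mul_relIndex (N ⊓ L) N (N ⊔ L) inf_le_left le_sup_left
  rw [inf_relIndex_right] at hL
  rw [inf_relIndex_left, relIndex_sup_left, mul_comm, ← hL] at hN
  rw [Nat.eq_of_mul_eq_mul_left (Nat.pos_of_ne_zero index_ne_zero_of_finite) hN]
  exact relIndex_dvd_index_of_le le_sup_right

lemma IsHallSubgroup.subgroupOf_normal [Finite G] {T : Subgroup G} (hT : IsHallSubgroup π T)
    (N : Subgroup G) [N.Normal] : IsHallSubgroup π (T.subgroupOf N) := by
  refine ⟨hT.1.of_dvd ?_, hT.2.of_dvd (relIndex_dvd_index_of_right_normal T N)⟩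
  exact card_comap_dvd_of_injective T N.subtype N.subtype_injective

lemma IsHallSubgroup.map {T : Subgroup G} (hT : IsHallSubgroup π T) {f : G →* Q}
    (hf : Function.Surjective f) : IsHallSubgroup π (T.map f) :=
  ⟨hT.1.of_dvd (card_map_dvd T f), hT.2.of_dvd (index_map_dvd T hf)⟩

lemma IsHallSubgroup.normal_le {T N : Subgroup G} [N.Normal] (hT : IsHallSubgroup π T)
    (hN : IsPiNumber π (Nat.card N)) : N ≤ T := by
  have hNT : N ⊔ T ≤ T := by
    rw [← relIndex_eq_one]
    exact ((isPiNumber_card_sup hN hT.1).of_dvd (relIndex_dvd_card T _)).eq_one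
      (hT.2.of_dvd (relIndex_dvd_index_of_le le_sup_right))
  exact le_sup_left.trans hNT

lemma IsHallSubgroup.isPiPrimeNumber_index {T M : Subgroup G} (hT : IsHallSubgroup π T)
    (hTM : T ≤ M) : IsPiPrimeNumber π M.index :=
  hT.2.of_dvd (index_dvd_of_le hTM)

end PiSubgroups

section Permutes

variable {G Q : Type*} [Group G] [Group Q] {V W T : Subgroup G}

lemma permutes_of_normal [hV : V.Normal] (T : Subgroup G) : Permutes V T := by
  rw [Permutes, ← normal_mul, ← mul_normal, sup_comm]

lemma Permutes.symm (h : Permutes V T) : Permutes T V :=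
  Eq.symm h

lemma permutes_comap_iff {f : G →* Q} (hf : Function.Surjective f) {V : Subgroup Q} :
    Permutes (V.comap f) T ↔ Permutes V (T.map f) := by
  have hVT : (V.comap f : Set G) * T = f ⁻¹' (V * T.map f) := by
    ext x
    refine ⟨?_, ?_⟩
    · rintro ⟨v, hv, t, ht, rfl⟩
      exact ⟨f v, hv, f t, mem_map_of_mem f ht, (map_mul f v t).symm⟩
    · rintro ⟨v, hv, _, ⟨t, ht, rfl⟩, hx⟩
      refine ⟨x * t⁻¹, ?_, t, ht, inv_mul_cancel_right x t⟩
      simpa [← eq_mul_inv_of_mul_eq hx] using hv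
  have hTV : (T : Set G) * V.comap f = f ⁻¹' (T.map f * V) :=
    calc (T : Set G) * V.comap f = ((V.comap f : Set G) * T)⁻¹ := by
          simp only [mul_inv_rev, inv_coe_set]
      _ = f ⁻¹' ((V * T.map f : Set Q)⁻¹) := by
          rw [hVT]
          ext x
          simp only [Set.mem_inv, Set.mem_preimage, map_inv]
      _ = f ⁻¹' (T.map f * V) := by simp only [mul_inv_rev, inv_coe_set]
  rw [Permutes, Permutes, hVT, hTV, hf.preimage_injective.eq_iff]

lemma Permutes.exists_conj_eq_mul [hW : W.Normal] (h : Permutes V T) (hVW : V ≤ W) {t v : G}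
    (ht : t ∈ T) (hv : v ∈ V) : ∃ a ∈ V, ∃ b ∈ T ⊓ W, t * v * t⁻¹ = a * b := by
  obtain ⟨a, ha, c, hc, hac⟩ : t * v ∈ (V : Set G) * T := h.ge (Set.mul_mem_mul ht hv)
  have hconj : t * v * t⁻¹ = a * (c * t⁻¹) := by rw [← hac, mul_assoc]
  have hW' : a * (c * t⁻¹) ∈ W := hconj ▸ hW.conj_mem v (hVW hv) t
  exact ⟨a, ha, c * t⁻¹, ⟨T.mul_mem hc (T.inv_mem ht), (W.mul_mem_cancel_left (hVW ha)).1 hW'⟩,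
    hconj⟩

lemma Permutes.le_normalizer [W.Normal] (h : Permutes V T) (hVW : V ≤ W) (hTW : T ⊓ W ≤ V) :
    T ≤ normalizer (V : Set G) := by
  refine le_normalizer_iff.2 fun t ht v hv => ?_
  obtain ⟨a, ha, b, hb, hab⟩ := h.exists_conj_eq_mul hVW ht hv
  exact hab ▸ V.mul_mem ha (hTW hb)

end Permutes

section PowerNormalizer

variable {G : Type*} [Group G] {W : Subgroup G} {g : G}

/-- The subgroup of all elements of `G` that induce power automorphisms in `W`, that is, the
intersection of the normalizers in `G` of the subgroups of `W`. For `W = ⊤` it is Baer's norm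
of `G`. -/
def powerNormalizer (W : Subgroup G) : Subgroup G :=
  ⨅ V : Set.Iic W, normalizer ((V : Subgroup G) : Set G)

lemma mem_powerNormalizer :
    g ∈ powerNormalizer W ↔ ∀ V ≤ W, g ∈ normalizer (V : Set G) := by
  simp only [powerNormalizer, mem_iInf, Subtype.forall, Set.mem_Iic]

lemma mem_powerNormalizer_iff_inducesPowerAutomorphism :
    g ∈ powerNormalizer W ↔ InducesPowerAutomorphism g W := by
  simp only [mem_powerNormalizer, mem_normalizer_iff_map_conj_eq]
  rfl

instance powerNormalizer_normal [hW : W.Normal] : (powerNormalizer W).Normal := by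
  refine ⟨fun n hn g => mem_powerNormalizer.2 fun V hVW => ?_⟩
  have hV : V.comap (MulAut.conj g).toMonoidHom ≤ W :=
    fun x hx => by simpa [mul_assoc] using hW.conj_mem _ (hVW hx) g⁻¹
  have hgn := le_normalizer_map (MulAut.conj g).toMonoidHom
    (mem_map_of_mem _ (mem_powerNormalizer.1 hn _ hV))
  rwa [map_comap_eq_self_of_surjective (MulAut.conj g).surjective] at hgn

end PowerNormalizer

section SigmaPermutable

variable {I : Type*} {σ : I → Set ℕ} {i j : I} {G Q : Type*} [Group G] [Group Q]

lemma IsSigmaFull.exists_isHallSubgroup (hfull : IsSigmaFull σ G) (i : I) :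
    ∃ T : Subgroup G, IsHallSubgroup (σ i) T := by
  by_cases hi : MemSigma σ G i
  · exact hfull i hi
  · refine ⟨⊥, card_bot (G := G) ▸ isPiNumber_one _, fun p hp hd hpi => hi ⟨p, hpi, hp, ?_⟩⟩
    rwa [index_bot] at hd

lemma IsSigmaFull.of_normal [Finite G] (hfull : IsSigmaFull σ G) (N : Subgroup G) [N.Normal] :
    IsSigmaFull σ N := fun i _ =>
  let ⟨_, hT⟩ := hfull.exists_isHallSubgroup i
  ⟨_, hT.subgroupOf_normal N⟩

lemma IsHallSubgroup.eq_bot_of_not_memSigma {T : Subgroup G} (hT : IsHallSubgroup (σ i) T)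
    (hi : ¬ MemSigma σ G i) : T = ⊥ :=
  card_eq_one.1 <| Nat.eq_one_iff_not_exists_prime_dvd.2 fun p hp hd =>
    hi ⟨p, hT.1 p hp hd, hp, hd.trans T.card_subgroup_dvd_card⟩

lemma IsSigmaPermutable.normal_or_permutes {V : Subgroup G} (hV : IsSigmaPermutable σ V) :
    V.Normal ∨ IsSigmaFull σ G ∧
      ∀ (i : I) (T : Subgroup G), IsHallSubgroup (σ i) T → Permutes V T := by
  refine hV.imp_right fun ⟨hfull, hperm⟩ => ⟨hfull, fun i T hT => ?_⟩
  by_cases hi : MemSigma σ G i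
  · exact hperm i hi T hT
  · rw [hT.eq_bot_of_not_memSigma hi]
    exact (permutes_of_normal V).symm

lemma IsSigmaPermutable.permutes {V T : Subgroup G} (hV : IsSigmaPermutable σ V)
    (hT : IsHallSubgroup (σ i) T) : Permutes V T := by
  rcases hV.normal_or_permutes with hn | ⟨-, hperm⟩
  · exact permutes_of_normal T
  · exact hperm i T hT

lemma IsHallSubgroup.eq_bot_or_eq_top (hσ : IsPrimePartition σ)
    (hG : IsPiNumber (σ i) (Nat.card G)) {T : Subgroup G} (hT : IsHallSubgroup (σ j) T) :
    T = ⊥ ∨ T = ⊤ := by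
  by_cases hij : i = j
  · subst hij
    exact Or.inr (index_eq_one.1 ((hG.of_dvd T.index_dvd_card).eq_one hT.2))
  · exact Or.inl (card_eq_one.1 (hT.1.eq_one
      ((hσ.isPiPrimeNumber_of_ne hij hG).of_dvd T.card_subgroup_dvd_card)))

lemma IsSigmaFull.isSigmaPermutable_comap (hσ : IsPrimePartition σ) (hfull : IsSigmaFull σ G)
    {f : G →* Q} (hf : Function.Surjective f) (hQ : IsPiNumber (σ i) (Nat.card Q))
    (V : Subgroup Q) : IsSigmaPermutable σ (V.comap f) := by
  refine Or.inr ⟨hfull, fun j _ T hT => (permutes_comap_iff hf).2 ?_⟩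
  have hn : (T.map f).Normal := by
    rcases (hT.map hf).eq_bot_or_eq_top hσ hQ with h | h <;> rw [h] <;> infer_instance
  exact (permutes_of_normal V).symm

end SigmaPermutable

section ChiefFactor

variable {π : Set ℕ} {G Q : Type*} [Group G] [Group Q]

lemma exists_isChiefFactor_bot_le [Finite G] {N : Subgroup G} [hN : N.Normal] (hne : N ≠ ⊥) :
    ∃ B ≤ N, IsChiefFactor ⊥ B := by
  obtain ⟨B, hBN, hB⟩ := exists_minimal_le_of_wellFoundedLT
    (fun M : Subgroup G => M.Normal ∧ M ≠ ⊥) N ⟨hN, hne⟩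
  refine ⟨B, hBN, inferInstance, hB.prop.1, hB.prop.2.bot_lt, fun M hM _ hMB => ?_⟩
  exact or_iff_not_imp_left.2 fun hM' => hB.eq_of_le ⟨hM, hM'⟩ hMB

lemma IsChiefFactor.comap {f : G →* Q} (hf : Function.Surjective f) {K H : Subgroup Q}
    (h : IsChiefFactor K H) : IsChiefFactor (K.comap f) (H.comap f) := by
  refine ⟨h.normal_bot.comap f, h.normal_top.comap f,
    (comap_lt_comap_of_surjective hf).2 h.lt, fun M hM hKM hMH => ?_⟩
  have hMf : (M.map f).comap f = M := comap_map_eq_self ((f.ker_le_comap K).trans hKM)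
  rw [← hMf]
  refine (h.eq_or_eq _ (hM.map f hf) ?_ (map_le_iff_le_comap.2 hMH)).imp
    (congrArg _) (congrArg _)
  rwa [← comap_le_comap_of_surjective hf, hMf]

lemma IsChiefFactor.map {f : G →* Q} (hf : Function.Surjective f) {K H : Subgroup G}
    (h : IsChiefFactor K H) (hK : f.ker ≤ K) : IsChiefFactor (K.map f) (H.map f) := by
  have hKf : (K.map f).comap f = K := comap_map_eq_self hK
  have hHf : (H.map f).comap f = H := comap_map_eq_self (hK.trans h.lt.le)
  refine ⟨h.normal_bot.map f hf, h.normal_top.map f hf, ?_, fun M hM hKM hMH => ?_⟩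
  · rw [← comap_lt_comap_of_surjective hf, hKf, hHf]
    exact h.lt
  · rw [← map_comap_eq_self_of_surjective hf M]
    exact (h.eq_or_eq _ (hM.comap f) (map_le_iff_le_comap.1 hKM)
      (hHf ▸ comap_mono hMH)).imp (congrArg _) (congrArg _)

lemma IsSupersoluble.of_surjective (hG : IsSupersoluble G) {f : G →* Q}
    (hf : Function.Surjective f) : IsSupersoluble Q := by
  intro K H h
  have := h.normal_bot
  have := hG _ _ (h.comap hf)
  refine isCyclic_of_surjective
    (QuotientGroup.map ((K.comap f).subgroupOf (H.comap f)) (K.subgroupOf H)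
      (f.subgroupComap H) fun x hx => hx) ?_
  exact QuotientGroup.map_surjective_of_surjective _ _ _
    (QuotientGroup.mk_surjective.comp (f.subgroupComap_surjective_of_surjective H hf)) _

lemma IsSupersoluble.isCyclic (hG : IsSupersoluble G) {B : Subgroup G}
    (hB : IsChiefFactor ⊥ B) : IsCyclic B := by
  have := hG ⊥ B hB
  refine isCyclic_of_injective (QuotientGroup.mk' ((⊥ : Subgroup G).subgroupOf B)) ?_
  rw [← MonoidHom.ker_eq_bot_iff, QuotientGroup.ker_mk', bot_subgroupOf]

lemma characteristic_of_isCyclic [IsCyclic G] (A : Subgroup G) : A.Characteristic := by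
  refine characteristic_iff_le_comap.2 fun φ a ha => ?_
  obtain ⟨m, hm⟩ := φ.toMonoidHom.map_cyclic
  exact mem_comap.2 (hm a ▸ A.zpow_mem ha m)

lemma isSimpleGroup_of_isChiefFactor_bot_top (h : IsChiefFactor ⊥ (⊤ : Subgroup G)) :
    IsSimpleGroup G where
  exists_pair_ne := (Subgroup.nontrivial_iff.1 ⟨⊥, ⊤, h.lt.ne⟩).exists_pair_ne
  eq_bot_or_eq_top_of_normal M hM := h.eq_or_eq M hM bot_le le_top

lemma isSimpleGroup_quotient_of_map {K H : Subgroup G} [K.Normal]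
    [IsSimpleGroup (H.map (QuotientGroup.mk' K))] : IsSimpleGroup (H ⧸ K.subgroupOf H) := by
  have hker : ((QuotientGroup.mk' K).subgroupMap H).ker = K.subgroupOf H := by
    rw [ker_subgroupMap, QuotientGroup.ker_mk']
  exact ((QuotientGroup.quotientMulEquivOfEq hker.symm).trans
    (QuotientGroup.quotientKerEquivOfSurjective _ (MonoidHom.subgroupMap_surjective _ H))
    ).isSimpleGroup

lemma le_normalizer_map_subtype {N : Subgroup G} (B : Subgroup N) [B.Normal] :
    N ≤ normalizer (B.map N.subtype : Set G) := by
  rw [← normal_subgroupOf_iff_le_normalizer (map_subtype_le B), subgroupOf,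
    comap_map_eq_self_of_injective N.subtype_injective]
  infer_instance

lemma IsChiefFactor.eq_top_of_normal_map {N : Subgroup G} (hN : IsChiefFactor ⊥ N)
    {B : Subgroup N} (hB : B ≠ ⊥) (hBn : (B.map N.subtype).Normal) : B = ⊤ := by
  have hBN : B.map N.subtype = N := by
    refine (hN.eq_or_eq _ hBn bot_le (map_subtype_le B)).resolve_left ?_
    exact (map_eq_bot_iff_of_injective B N.subtype_injective).not.2 hB
  refine map_injective N.subtype_injective ?_
  rw [hBN, ← MonoidHom.range_eq_map, range_subtype]

lemma IsChiefFactor.isPiNumber_card [Finite G] {N : Subgroup G} (hN : IsChiefFactor ⊥ N)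
    {B : Subgroup N} [hBn : B.Normal] (hB : B ≠ ⊥) (hBπ : IsPiNumber π (Nat.card B)) :
    IsPiNumber π (Nat.card N) := by
  have := hN.normal_top
  have := piCore_characteristic π N
  have hcore : piCore π N = ⊤ :=
    hN.eq_top_of_normal_map (ne_bot_of_le_ne_bot hB (le_sSup ⟨hBn, hBπ⟩)) inferInstance
  rw [← card_top, ← hcore]
  exact (piCore_normal_and_isPiNumber_card π).2

lemma IsChiefFactor.inf_map_eq_bot [Finite G] {B : Subgroup G} (hB : IsChiefFactor ⊥ B)
    (φ : G ≃* G) (hφ : B.map φ.toMonoidHom ≠ B) : B ⊓ B.map φ.toMonoidHom = ⊥ := by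
  have := hB.normal_top
  have : (B.map φ.toMonoidHom).Normal := hB.normal_top.map _ φ.surjective
  refine (hB.eq_or_eq _ inferInstance bot_le inf_le_left).resolve_right fun h => hφ ?_
  exact (eq_of_le_of_card_ge (inf_eq_left.1 h)
    (card_map_of_injective (K := B) φ.injective).le).symm

lemma IsChiefFactor.isPiNumber_card_of_permutes [Finite G] {N : Subgroup G} [N.Normal]
    {B : Subgroup N} (hB : IsChiefFactor ⊥ B) {L : Subgroup G} (hL : IsPiNumber π (Nat.card L))
    (hperm : Permutes (B.map N.subtype) L)
    (hLB : ¬ L ≤ normalizer (B.map N.subtype : Set G)) : IsPiNumber π (Nat.card B) := by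
  have := hB.normal_top
  obtain ⟨l, hl, hlB⟩ : ∃ l ∈ L, B.map (MulAut.conjNormal l).toMonoidHom ≠ B := by
    by_contra! hfix
    refine hLB fun l hl => mem_normalizer_iff_map_conj_eq.2 ?_
    conv_rhs => rw [← hfix l hl]
    simp only [map_map]
    rfl
  set C := B.map (MulAut.conjNormal l).toMonoidHom
  -- Modulo `B`, the conjugate `C` embeds in `L ⊓ N`.
  have hCL : C.map (QuotientGroup.mk' B) ≤ (L.subgroupOf N).map (QuotientGroup.mk' B) := by
    rintro _ ⟨_, ⟨b, hb, rfl⟩, rfl⟩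
    obtain ⟨_, ⟨a, ha, rfl⟩, c, ⟨hcL, hcN⟩, hac⟩ :=
      hperm.exists_conj_eq_mul (map_subtype_le B) hl (mem_map_of_mem N.subtype hb)
    have hconj : MulAut.conjNormal l b = a * ⟨c, hcN⟩ := Subtype.ext hac
    have ha' : QuotientGroup.mk' B a = 1 := (QuotientGroup.eq_one_iff a).2 ha
    refine ⟨⟨c, hcN⟩, hcL, ?_⟩
    calc QuotientGroup.mk' B ⟨c, hcN⟩ = QuotientGroup.mk' B (a * ⟨c, hcN⟩) := by
          rw [map_mul, ha', one_mul]
      _ = QuotientGroup.mk' B (MulAut.conjNormal l b) := by rw [hconj]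
  have hcard : Nat.card (C.map (QuotientGroup.mk' B)) = Nat.card B := by
    rw [← relIndex_ker, QuotientGroup.ker_mk', ← inf_relIndex_right,
      hB.inf_map_eq_bot _ hlB, relIndex_bot_left, card_map_of_injective (MulEquiv.injective _)]
  rw [← hcard]
  exact hL.of_dvd ((card_dvd_of_le hCL).trans ((card_map_dvd _ _).trans
    (card_comap_dvd_of_injective L N.subtype N.subtype_injective)))

end ChiefFactor

section PSigmaT

variable {I : Type*} {σ : I → Set ℕ} {i j : I} {G Q : Type*} [Group G] [Group Q] {f : G →* Q}

lemma normal_of_forall_isHallSubgroup_le_normalizer (hσ : IsPrimePartition σ) {V : Subgroup G}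
    (hV : ∀ j, ∃ T : Subgroup G, IsHallSubgroup (σ j) T ∧ T ≤ normalizer (V : Set G)) :
    V.Normal :=
  normalizer_eq_top_iff.1 <| index_eq_one.1 <| hσ.eq_one_of_forall fun j =>
    let ⟨_, hT, hTV⟩ := hV j
    hT.isPiPrimeNumber_index hTV

lemma IsPSigmaTGroup.isSigmaPermutable_of_normal (hG : IsPSigmaTGroup σ G) {V W : Subgroup G}
    [hW : W.Normal] (hVW : V ≤ W) (hV : IsSigmaPermutable σ (V.subgroupOf W)) :
    IsSigmaPermutable σ V :=
  hG V W hVW hV (Or.inl hW)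

variable [Finite G]

lemma IsPSigmaTGroup.map_isHallSubgroup_le_normalizer (hσ : IsPrimePartition σ)
    (hG : IsPSigmaTGroup σ G) (hfull : IsSigmaFull σ G) (hf : Function.Surjective f)
    (hij : i ≠ j) {V W : Subgroup Q} [W.Normal] (hW : IsPiNumber (σ i) (Nat.card W))
    (hVW : V ≤ W) {T : Subgroup G} (hT : IsHallSubgroup (σ j) T) :
    T.map f ≤ normalizer (V : Set Q) := by
  have hperm : IsSigmaPermutable σ (V.comap f) := by
    refine hG.isSigmaPermutable_of_normal (comap_mono hVW : V.comap f ≤ W.comap f) ?_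
    exact (hfull.of_normal _).isSigmaPermutable_comap hσ
      (f.subgroupComap_surjective_of_surjective W hf) hW (V.subgroupOf W)
  have hTW : T.map f ⊓ W = ⊥ := by
    rw [← card_eq_one]
    exact (hW.of_dvd (card_dvd_of_le inf_le_right)).eq_one
      ((hσ.isPiPrimeNumber_of_ne hij.symm (hT.map hf).1).of_dvd (card_dvd_of_le inf_le_left))
  exact ((permutes_comap_iff hf).1 (hperm.permutes hT)).le_normalizer hVW (hTW ▸ bot_le)

lemma IsPSigmaTGroup.inducesPowerAutomorphism_of_isPiNumber_card (hσ : IsPrimePartition σ)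
    (hG : IsPSigmaTGroup σ G) (hfull : IsSigmaFull σ G) (hf : Function.Surjective f)
    {W : Subgroup Q} [W.Normal] (hW : IsPiNumber (σ i) (Nat.card W)) {q : Q}
    (hq : IsPiPrimeNumber (σ i) (orderOf q)) : InducesPowerAutomorphism q W := by
  have hindex : IsPiNumber (σ i) (powerNormalizer W).index := by
    refine hσ.isPiNumber_of_forall_ne fun j hji => ?_
    obtain ⟨T, hT⟩ := hfull.exists_isHallSubgroup j
    exact (hT.map hf).isPiPrimeNumber_index fun t ht => mem_powerNormalizer.2 fun V hVW =>
      hG.map_isHallSubgroup_le_normalizer hσ hfull hf hji.symm hW hVW hT ht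
  exact mem_powerNormalizer_iff_inducesPowerAutomorphism.1
    (mem_of_isPiPrimeNumber_orderOf hindex hq)

lemma IsPSigmaTGroup.isCyclic_of_isPiNumber_card (hσ : IsPrimePartition σ)
    (hG : IsPSigmaTGroup σ G) (hfull : IsSigmaFull σ G) (hf : Function.Surjective f)
    {N : Subgroup Q} (hN : IsChiefFactor ⊥ N) (hNπ : IsPiNumber (σ i) (Nat.card N))
    {L : Subgroup G} (hL : IsHallSubgroup (σ i) L) (hLsup : IsSupersoluble L) : IsCyclic N := by
  have : Finite Q := Finite.of_surjective f hf
  have := hN.normal_top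
  have hNL : N ≤ L.map f := (hL.map hf).normal_le hNπ
  have hne : N.subgroupOf (L.map f) ≠ ⊥ := by
    rw [Ne, subgroupOf_eq_bot, disjoint_iff, inf_eq_left.2 hNL]
    exact hN.lt.ne'
  obtain ⟨B, hBN, hB⟩ := exists_isChiefFactor_bot_le hne
  have := hB.normal_top
  set V := B.map (L.map f).subtype
  have hVN : V ≤ N := map_le_iff_le_comap.2 hBN
  have hV : V.Normal := by
    refine normal_of_forall_isHallSubgroup_le_normalizer hσ fun j => ?_
    by_cases hij : i = j
    · exact ⟨L.map f, hij ▸ hL.map hf, le_normalizer_map_subtype B⟩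
    · obtain ⟨T, hT⟩ := hfull.exists_isHallSubgroup j
      exact ⟨T.map f, hT.map hf, hG.map_isHallSubgroup_le_normalizer hσ hfull hf hij hNπ hVN hT⟩
  have hVN' : V = N := (hN.eq_or_eq V hV bot_le hVN).resolve_left
    ((map_eq_bot_iff_of_injective B (subtype_injective _)).not.2 hB.lt.ne')
  have hBcyc : IsCyclic B := (hLsup.of_surjective (f.subgroupMap_surjective L)).isCyclic hB
  exact hVN' ▸ (B.equivMapOfInjective _ (subtype_injective _)).isCyclic.1 hBcyc

lemma IsPSigmaTGroup.isCyclic_of_not_normal_map (hσ : IsPrimePartition σ)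
    (hG : IsPSigmaTGroup σ G)
    (hsup : ∀ (i : I) (L : Subgroup G), IsHallSubgroup (σ i) L → IsSupersoluble L)
    (hf : Function.Surjective f) {N : Subgroup Q} (hN : IsChiefFactor ⊥ N) {B : Subgroup N}
    (hB : IsChiefFactor ⊥ B) (hBn : ¬ (B.map N.subtype).Normal) : IsCyclic N := by
  have : Finite Q := Finite.of_surjective f hf
  have := hN.normal_top
  have := hB.normal_top
  set V := B.map N.subtype
  have hV : IsSigmaPermutable σ (V.comap f) := by
    refine hG.isSigmaPermutable_of_normal (comap_mono (map_subtype_le B)) (Or.inl ?_)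
    exact normal_subgroupOf_of_le_normalizer
      ((comap_mono (le_normalizer_map_subtype B)).trans (le_normalizer_comap f))
  obtain ⟨hfull, hperm⟩ := hV.normal_or_permutes.resolve_left fun hn =>
    hBn (map_comap_eq_self_of_surjective hf V ▸ hn.map f hf)
  obtain ⟨i, L, hL, hLV⟩ : ∃ (i : I) (L : Subgroup G), IsHallSubgroup (σ i) L ∧
      ¬ L.map f ≤ normalizer (V : Set Q) := by
    by_contra! hle
    refine hBn (normal_of_forall_isHallSubgroup_le_normalizer hσ fun j => ?_)
    obtain ⟨T, hT⟩ := hfull.exists_isHallSubgroup j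
    exact ⟨T.map f, hT.map hf, hle j T hT⟩
  have hBσ : IsPiNumber (σ i) (Nat.card B) :=
    hB.isPiNumber_card_of_permutes (hL.map hf).1 ((permutes_comap_iff hf).1 (hperm i L hL)) hLV
  exact hG.isCyclic_of_isPiNumber_card hσ hfull hf hN (hN.isPiNumber_card hB.lt.ne' hBσ) hL
    (hsup i L hL)

lemma IsPSigmaTGroup.isSimpleGroup_of_isChiefFactor_bot (hσ : IsPrimePartition σ)
    (hG : IsPSigmaTGroup σ G)
    (hsup : ∀ (i : I) (L : Subgroup G), IsHallSubgroup (σ i) L → IsSupersoluble L)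
    (hf : Function.Surjective f) {N : Subgroup Q} (hN : IsChiefFactor ⊥ N) : IsSimpleGroup N := by
  have : Finite Q := Finite.of_surjective f hf
  have := hN.normal_top
  have : Nontrivial N := N.nontrivial_iff_ne_bot.2 hN.lt.ne'
  obtain ⟨B, -, hB⟩ := exists_isChiefFactor_bot_le (top_ne_bot (α := Subgroup N))
  have hBn : (B.map N.subtype).Normal := by
    by_contra hBn
    have : IsCyclic N := hG.isCyclic_of_not_normal_map hσ hsup hf hN hB hBn
    have := characteristic_of_isCyclic B
    exact hBn inferInstance
  exact isSimpleGroup_of_isChiefFactor_bot_top (hN.eq_top_of_normal_map hB.lt.ne' hBn ▸ hB)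

end PSigmaT

end SigmaGroup

theorem proposition2p29_general {I : Type*} (σ : I → Set ℕ) (hσ : SigmaGroup.IsPrimePartition σ)
    (G : Type*) [Group G] [Finite G] (hG : SigmaGroup.IsPSigmaTGroup σ G) :
    (SigmaGroup.IsSigmaFull σ G →
      ∀ (Q : Type*) [Group Q] (f : G →* Q), Function.Surjective f →
        ∀ (i : I) (q : Q), SigmaGroup.IsPiPrimeNumber (σ i) (orderOf q) →
          SigmaGroup.InducesPowerAutomorphism q (SigmaGroup.piCore (σ i) Q)) ∧
    ((∀ (i : I) (H : Subgroup G), SigmaGroup.IsHallSubgroup (σ i) H →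
        SigmaGroup.IsSupersoluble H) →
      ∀ K H : Subgroup G, ∀ h : SigmaGroup.IsChiefFactor K H,
        haveI := h.normal_bot
        IsSimpleGroup (H ⧸ K.subgroupOf H)) := by
  refine ⟨fun hfull Q _ f hf i q hq => ?_, fun hsup K H h => ?_⟩
  · have : Finite Q := Finite.of_surjective f hf
    obtain ⟨hnormal, hcard⟩ := SigmaGroup.piCore_normal_and_isPiNumber_card (G := Q) (σ i)
    exact hG.inducesPowerAutomorphism_of_isPiNumber_card hσ hfull hf hcard hq
  · have := h.normal_bot
    have hmk := QuotientGroup.mk'_surjective K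
    have hmin := h.map hmk (QuotientGroup.ker_mk' K).le
    rw [QuotientGroup.map_mk'_self] at hmin
    have := hG.isSimpleGroup_of_isChiefFactor_bot hσ hsup hmk hmin
    exact SigmaGroup.isSimpleGroup_quotient_of_map

theorem proposition2p29 {I : Type*} (σ : I → Set ℕ) (hσ : SigmaGroup.IsPrimePartition σ)
    (G : Type*) [Group G] [Finite G] (hG : SigmaGroup.IsPSigmaTGroup σ G) :
    (SigmaGroup.IsSigmaFull σ G →
      ∀ (R : Subgroup G) [R.Normal] (i : I), SigmaGroup.SatisfiesN (σ i) (G ⧸ R)) ∧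
    ((∀ (i : I) (H : Subgroup G), SigmaGroup.IsHallSubgroup (σ i) H →
        SigmaGroup.IsSupersoluble H) →
      SigmaGroup.IsSigmaSCGroup σ G) := by
  obtain ⟨hpower, hsimple⟩ := proposition2p29_general σ hσ G hG
  refine ⟨fun hfull R _ i N _ _ g hg => ?_, fun hsup K H h _ => hsimple hsup K H h⟩
  exact hpower hfull _ ((QuotientGroup.mk' N).comp (QuotientGroup.mk' R))
    ((QuotientGroup.mk'_surjective N).comp (QuotientGroup.mk'_surjective R)) i g
    (hg.of_dvd (orderOf_map_dvd (QuotientGroup.mk' N) g))
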